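/- Let $h>0$ and $\omega_0>1$ be real, and let $\mathbb{H}_h=\{\omega\in\mathbb{C}:\operatorname{Im}\omega>-h\}$. Let $H^2(\mathbb{H}_h)$ be the Hardy space of functions $f$ analytic in $\mathbb{H}_h$ with $\sup_{y>-h}\|f\|_{L^2(\mathbb{R}+iy)}<\infty$, normed by $\|f\|_{H^2(\mathbb{H}_h)}=\|f\|_{L^2(\mathbb{R}-ih)}$, the $L^2$ norm of the boundary values $\lim_{y\downarrow -h}f(x+iy)$ (which exist for a.e. $x$), and let $Sf(\omega)=\overline{f(-\overline{\omega})}$. For $\epsilon>0$ put $$D_h^0(\epsilon)=\sup\{|f(\omega_0)|: f\in H^2(\mathbb{H}_h),\ \|f\|_{H^2(\mathbb{H}_h)}\le 1,\ \|f\|_{L^2(-1,1)}\le\epsilon\},$$ $$D_h(\epsilon)=\sup\{|f(\omega_0)|: f\in H^2(\mathbb{H}_h),\ Sf=f,\ \|f\|_{H^2(\mathbb{H}_h)}\le 1,\ \|f\|_{L^2(-1,1)}\le\epsilon\}.$$ Then both suprema are finite and positive, and for every $\epsilon>0$ $$\tfrac12 D_h^0(\epsilon)\le D_h(\epsilon)\le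 D_h^0(\epsilon).$$ Consequently, the problems with and without symmetry have the same power-law exponent: $$\liminf_{\epsilon\to0^+}\frac{\ln D_h(\epsilon)}{\ln\epsilon}=\liminf_{\epsilon\to0^+}\frac{\ln D_h^0(\epsilon)}{\ln\epsilon},$$ and, for every real $\gamma$, $\ln D_h(\epsilon)/\ln\epsilon\to\gamma$ as $\epsilon\to0^+$ if and only if $\ln D_h^0(\epsilon)/\ln\epsilon\to\gamma$. -/

import Mathlib

open Set Filter Topology MeasureTheory
open scoped ENNReal ComplexConjugate

noncomputable section

namespace HardyExtrapolation

/-- The half-plane `{ω : Im ω > -h}`. -/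
def halfPlane (h : ℝ) : Set ℂ := {ω | -h < ω.im}

/-- The Hardy class `H²` of the half-plane `Im ω > -h`: functions analytic there whose `L²` norms
over the horizontal lines `Im ω = y`, `y > -h`, are uniformly bounded. Only the values of `f` on
the half-plane matter. -/
def MemHardy (h : ℝ) (f : ℂ → ℂ) : Prop :=
  DifferentiableOn ℂ f (halfPlane h) ∧
    ⨆ y ∈ Ioi (-h), eLpNorm (fun x : ℝ => f (x + y * Complex.I)) 2 volume < ∞

/-- `g` is the `L²` boundary data of `f` on the line `ℝ - ih`: for almost every `x`,
`f (x + iy) → g x` as `y ↓ -h`. Such a `g` is unique up to null sets. -/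
def HasBoundaryData (h : ℝ) (f : ℂ → ℂ) (g : ℝ → ℂ) : Prop :=
  MemLp g 2 volume ∧
    ∀ᵐ x : ℝ, Tendsto (fun y : ℝ => f (x + y * Complex.I)) (𝓝[>] (-h)) (𝓝 (g x))

/-- The Hardy norm `‖f‖ = ‖f‖_{L²(ℝ - ih)}`, the `L²` norm of the boundary data. All boundary data
of `f` agree almost everywhere, so the infimum is over a single value (every `f` in the Hardy class
has boundary data; a function without boundary data gets the value `∞`). -/
def hardyNorm (h : ℝ) (f : ℂ → ℂ) : ℝ≥0∞ :=
  ⨅ (g : ℝ → ℂ) (_ : HasBoundaryData h f g), eLpNorm g 2 volume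

/-- The norm of `f` in `L²(-1,1)`. -/
def bandNorm (f : ℂ → ℂ) : ℝ≥0∞ :=
  eLpNorm (fun x : ℝ => f x) 2 (volume.restrict (Ioo (-1 : ℝ) 1))

/-- The operator `(S f)(ω) = conj (f (-conj ω))`. -/
def symm (f : ℂ → ℂ) : ℂ → ℂ := fun ω => conj (f (-conj ω))

/-- Functions admissible for the problem without symmetry. -/
def admissible₀ (h ε : ℝ) : Set (ℂ → ℂ) :=
  {f | MemHardy h f ∧ hardyNorm h f ≤ 1 ∧ bandNorm f ≤ ENNReal.ofReal ε}

/-- Functions admissible for the problem with the symmetry constraint `S f = f`. -/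
def admissible (h ε : ℝ) : Set (ℂ → ℂ) :=
  {f | MemHardy h f ∧ EqOn (symm f) f (halfPlane h) ∧ hardyNorm h f ≤ 1 ∧
    bandNorm f ≤ ENNReal.ofReal ε}

/-- The worst-case value at `ω₀` without symmetry. -/
def D₀ (ω₀ h ε : ℝ) : ℝ := sSup ((fun f : ℂ → ℂ => ‖f ω₀‖) '' admissible₀ h ε)

/-- The worst-case value at `ω₀` with the symmetry constraint. -/
def D (ω₀ h ε : ℝ) : ℝ := sSup ((fun f : ℂ → ℂ => ‖f ω₀‖) '' admissible h ε)

/-- The power-law exponent `liminf_{ε → 0⁺} ln E(ε) / ln ε` of an error bound `E`. -/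
def powerLawExponent (E : ℝ → ℝ) : EReal :=
  liminf (fun ε : ℝ => ((Real.log (E ε) / Real.log ε : ℝ) : EReal)) (𝓝[>] 0)

end HardyExtrapolation

end

/-!
Two ingredients give the comparison of the suprema. The first is the symmetrisation
`symmPart f = (f + S f) / 2`. Since `S` is reflection `x ↦ -x` followed by conjugation on each
horizontal line, it preserves the Hardy class, the boundary norm and the band norm, so `symmPart`
sends functions admissible for the unconstrained problem to functions admissible for the symmetric
one. As `S` is antilinear, `f = symmPart f + i symmPart (-i f)`, hence `|f(ω₀)| ≤ 2 D`.

The second is the finiteness of the suprema, where the norm is that of the boundary values only.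
It rests on the Cauchy formula
`∫ g(x) / (x - ih - a) dx = 2πi f(a)` for the boundary data `g` of `f`
(`HasBoundaryData.integral_mul_cauchyKernel`) and the Cauchy–Schwarz inequality. No representation
theorem for Hardy functions is used. If `f(a) = 0`, then `f / (ω - a)` is holomorphic and Cauchy's
theorem shows that its integral over a line below `a` equals the one over a line at height `Y`,
which is `O(Y ^ (-1/2))`; so it vanishes (`MemHardy.integral_mul_cauchyKernel_eq_zero`). The lines
then descend to the boundary: the restrictions of `f` are bounded in `L²` and converge almost
everywhere, which suffices for convergence of their pairings with the Cauchy kernel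
(`tendsto_integral_mul_of_bounded_of_dominated`). The general case follows by subtracting from `f`
a multiple of a simple pole at `a - 2ih`.

Small multiples of `i / (ω + 2ih)` show that the suprema are positive. The exponents agree because
the logarithms of the two suprema differ by at most `ln 2`, which disappears after division by
`ln ε`.
-/

namespace HardyExtrapolation

/-! ### The symmetry `S` and the symmetric part of a function -/

lemma add_mul_I_mem_halfPlane {h y : ℝ} (hy : -h < y) (x : ℝ) :
    (x + y * Complex.I : ℂ) ∈ halfPlane h := by
  simpa [halfPlane] using hy

lemma isOpen_halfPlane (h : ℝ) : IsOpen (halfPlane h) :=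
  isOpen_lt continuous_const Complex.continuous_im

lemma neg_conj_mem_halfPlane {h : ℝ} {ω : ℂ} (hω : ω ∈ halfPlane h) :
    -conj ω ∈ halfPlane h := by
  simpa [halfPlane] using hω

lemma MemHardy.continuous_line {h y : ℝ} {f : ℂ → ℂ} (hf : MemHardy h f) (hy : -h < y) :
    Continuous fun x : ℝ => f (x + y * Complex.I) :=
  hf.1.continuousOn.comp_continuous (by fun_prop) (add_mul_I_mem_halfPlane hy)

lemma MemHardy.aestronglyMeasurable_line {h y : ℝ} {f : ℂ → ℂ} (hf : MemHardy h f)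
    (hy : -h < y) (μ : Measure ℝ) :
    AEStronglyMeasurable (fun x : ℝ => f (x + y * Complex.I)) μ :=
  (hf.continuous_line hy).aestronglyMeasurable

lemma MemHardy.aestronglyMeasurable_real {h : ℝ} (hh : 0 < h) {f : ℂ → ℂ} (hf : MemHardy h f)
    (μ : Measure ℝ) : AEStronglyMeasurable (fun x : ℝ => f x) μ := by
  simpa using hf.aestronglyMeasurable_line (y := 0) (by linarith) μ

lemma memHardy_of_forall_le {h : ℝ} {f : ℂ → ℂ} {M : ℝ≥0∞}
    (hd : DifferentiableOn ℂ f (halfPlane h)) (hM : M ≠ ∞)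
    (hle : ∀ y > -h, eLpNorm (fun x : ℝ => f (x + y * Complex.I)) 2 volume ≤ M) :
    MemHardy h f :=
  ⟨hd, (iSup₂_le hle).trans_lt hM.lt_top⟩

lemma MemHardy.exists_bound {h : ℝ} {f : ℂ → ℂ} (hf : MemHardy h f) :
    ∃ M : ℝ≥0∞, M ≠ ∞ ∧
      ∀ y > -h, eLpNorm (fun x : ℝ => f (x + y * Complex.I)) 2 volume ≤ M :=
  ⟨_, hf.2.ne, fun y hy =>
    le_iSup₂ (f := fun y (_ : y ∈ Ioi (-h)) =>
      eLpNorm (fun x : ℝ => f (x + y * Complex.I)) 2 volume) y hy⟩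

lemma MemHardy.add {h : ℝ} {f g : ℂ → ℂ} (hf : MemHardy h f) (hg : MemHardy h g) :
    MemHardy h fun ω => f ω + g ω := by
  obtain ⟨M, hM, hfM⟩ := hf.exists_bound
  obtain ⟨N, hN, hgN⟩ := hg.exists_bound
  refine memHardy_of_forall_le (hf.1.add hg.1) (ENNReal.add_ne_top.2 ⟨hM, hN⟩) fun y hy => ?_
  exact (eLpNorm_add_le (hf.aestronglyMeasurable_line hy _) (hg.aestronglyMeasurable_line hy _)
    (by norm_num)).trans (add_le_add (hfM y hy) (hgN y hy))

lemma MemHardy.const_mul {h : ℝ} {f : ℂ → ℂ} (hf : MemHardy h f) (c : ℂ) :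
    MemHardy h fun ω => c * f ω := by
  obtain ⟨M, hM, hfM⟩ := hf.exists_bound
  refine memHardy_of_forall_le (hf.1.const_mul c)
    (ENNReal.mul_ne_top (enorm_ne_top (x := c)) hM) fun y hy => ?_
  exact (eLpNorm_const_smul_le (c := c)).trans (mul_le_mul_right (hfM y hy) _)

lemma symm_line (f : ℂ → ℂ) (x y : ℝ) :
    symm f (x + y * Complex.I) = conj (f ((-x : ℝ) + y * Complex.I)) := by
  simp only [symm]
  congr 2
  simp [add_comm]

lemma eLpNorm_conj_comp_neg {g : ℝ → ℂ} {s : Set ℝ} (hs : MeasurableSet s) (hs' : -s = s)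
    (hg : AEStronglyMeasurable g (volume.restrict s)) :
    eLpNorm (fun x : ℝ => conj (g (-x))) 2 (volume.restrict s) =
      eLpNorm g 2 (volume.restrict s) := by
  have hp : MeasurePreserving (Neg.neg : ℝ → ℝ) (volume.restrict s) (volume.restrict s) := by
    have := (Measure.measurePreserving_neg (volume : Measure ℝ)).restrict_preimage hs
    rwa [show (Neg.neg ⁻¹' s : Set ℝ) = s from hs'] at this
  rw [← eLpNorm_comp_measurePreserving hg hp]
  exact eLpNorm_congr_norm_ae (ae_of_all _ fun x => by simp)

lemma eLpNorm_conj_comp_neg_univ {g : ℝ → ℂ} (hg : AEStronglyMeasurable g volume) :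
    eLpNorm (fun x : ℝ => conj (g (-x))) 2 volume = eLpNorm g 2 volume := by
  simpa using eLpNorm_conj_comp_neg MeasurableSet.univ (by simp) (by simpa using hg)

lemma aestronglyMeasurable_conj_comp_neg {g : ℝ → ℂ} (hg : AEStronglyMeasurable g volume) :
    AEStronglyMeasurable (fun x : ℝ => conj (g (-x))) volume :=
  Complex.continuous_conj.comp_aestronglyMeasurable
    (hg.comp_measurePreserving (Measure.measurePreserving_neg (volume : Measure ℝ)))

lemma MemHardy.symm {h : ℝ} {f : ℂ → ℂ} (hf : MemHardy h f) :
    MemHardy h (HardyExtrapolation.symm f) := by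
  obtain ⟨M, hM, hfM⟩ := hf.exists_bound
  refine memHardy_of_forall_le (fun ω hω => ?_) hM fun y hy => ?_
  · have h1 : DifferentiableAt ℂ f (-conj ω) :=
      hf.1.differentiableAt ((isOpen_halfPlane h).mem_nhds (neg_conj_mem_halfPlane hω))
    have h2 : DifferentiableAt ℂ (f ∘ Neg.neg) (conj ω) :=
      DifferentiableAt.comp _ h1 differentiableAt_id.neg
    exact (differentiableAt_conj_conj_iff.2 h2).differentiableWithinAt
  · simp only [symm_line]
    exact (eLpNorm_conj_comp_neg_univ (hf.aestronglyMeasurable_line hy _)).trans_le (hfM y hy)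

lemma HasBoundaryData.add {h : ℝ} {f₁ f₂ : ℂ → ℂ} {g₁ g₂ : ℝ → ℂ}
    (h₁ : HasBoundaryData h f₁ g₁) (h₂ : HasBoundaryData h f₂ g₂) :
    HasBoundaryData h (fun ω => f₁ ω + f₂ ω) (fun x => g₁ x + g₂ x) :=
  ⟨h₁.1.add h₂.1, by filter_upwards [h₁.2, h₂.2] with x hx hx' using hx.add hx'⟩

lemma HasBoundaryData.const_mul {h : ℝ} {f : ℂ → ℂ} {g : ℝ → ℂ}
    (hg : HasBoundaryData h f g) (c : ℂ) :
    HasBoundaryData h (fun ω => c * f ω) (fun x => c * g x) :=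
  ⟨hg.1.const_mul c, by filter_upwards [hg.2] with x hx using hx.const_mul c⟩

lemma HasBoundaryData.symm {h : ℝ} {f : ℂ → ℂ} {g : ℝ → ℂ} (hg : HasBoundaryData h f g) :
    HasBoundaryData h (HardyExtrapolation.symm f) (fun x => conj (g (-x))) := by
  refine ⟨⟨aestronglyMeasurable_conj_comp_neg hg.1.1, ?_⟩, ?_⟩
  · rw [eLpNorm_conj_comp_neg_univ hg.1.1]
    exact hg.1.2
  · filter_upwards [(Measure.measurePreserving_neg
      (volume : Measure ℝ)).quasiMeasurePreserving.ae hg.2] with x hx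
    simp only [symm_line]
    exact (Complex.continuous_conj.tendsto _).comp hx

lemma hardyNorm_le_eLpNorm {h : ℝ} {f : ℂ → ℂ} {g : ℝ → ℂ} (hg : HasBoundaryData h f g) :
    hardyNorm h f ≤ eLpNorm g 2 volume :=
  iInf₂_le g hg

lemma exists_hasBoundaryData_of_hardyNorm_lt {h : ℝ} {f : ℂ → ℂ} {a : ℝ≥0∞}
    (hf : hardyNorm h f < a) :
    ∃ g, HasBoundaryData h f g ∧ eLpNorm g 2 volume < a := by
  simpa only [hardyNorm, iInf_lt_iff, exists_prop] using hf

lemma hardyNorm_const_mul_le (h : ℝ) (f : ℂ → ℂ) {c : ℂ} (hc : ‖c‖ ≤ 1) :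
    hardyNorm h (fun ω => c * f ω) ≤ hardyNorm h f := by
  refine le_iInf₂ fun g hg => (hardyNorm_le_eLpNorm (hg.const_mul c)).trans ?_
  exact eLpNorm_mono fun x => by
    simpa using mul_le_mul_of_nonneg_right hc (norm_nonneg (g x))

lemma bandNorm_const_mul_le (f : ℂ → ℂ) {c : ℂ} (hc : ‖c‖ ≤ 1) :
    bandNorm (fun ω => c * f ω) ≤ bandNorm f :=
  eLpNorm_mono fun x => by
    simpa using mul_le_mul_of_nonneg_right hc (norm_nonneg (f x))

lemma const_mul_mem_admissible₀ {h ε : ℝ} {f : ℂ → ℂ} (hf : f ∈ admissible₀ h ε) {c : ℂ}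
    (hc : ‖c‖ ≤ 1) : (fun ω => c * f ω) ∈ admissible₀ h ε :=
  ⟨hf.1.const_mul c, (hardyNorm_const_mul_le h f hc).trans hf.2.1,
    (bandNorm_const_mul_le f hc).trans hf.2.2⟩

/-- The symmetric part `(f + S f) / 2`, the projection of `f` onto the fixed points of `S`. -/
noncomputable def symmPart (f : ℂ → ℂ) : ℂ → ℂ := fun ω => 2⁻¹ * (f ω + symm f ω)

lemma symm_symmPart (f : ℂ → ℂ) : symm (symmPart f) = symmPart f := by
  funext ω
  simp only [symmPart, symm, map_mul, map_add, map_inv₀, map_ofNat, map_neg, Complex.conj_conj,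
    neg_neg, add_comm]

/-- Averaging two functions of equal norm does not increase the norm. -/
lemma eLpNorm_half_add_le {μ : Measure ℝ} {u v : ℝ → ℂ} (hu : AEStronglyMeasurable u μ)
    (hv : AEStronglyMeasurable v μ) (huv : eLpNorm v 2 μ = eLpNorm u 2 μ) :
    eLpNorm (fun x => (2⁻¹ : ℂ) * (u x + v x)) 2 μ ≤ eLpNorm u 2 μ := by
  calc eLpNorm (fun x => (2⁻¹ : ℂ) * (u x + v x)) 2 μ
      ≤ ‖(2⁻¹ : ℂ)‖ₑ * eLpNorm (u + v) 2 μ := eLpNorm_const_smul_le (c := (2⁻¹ : ℂ))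
    _ ≤ ‖(2⁻¹ : ℂ)‖ₑ * (eLpNorm u 2 μ + eLpNorm u 2 μ) := by
        gcongr
        exact (eLpNorm_add_le hu hv (by norm_num)).trans_eq (by rw [huv])
    _ = eLpNorm u 2 μ := by
        have : ‖(2⁻¹ : ℂ)‖ₑ = 2⁻¹ := by
          rw [enorm_inv (by norm_num), ← ofReal_norm]
          simp
        rw [this, ← two_mul, ← mul_assoc, ENNReal.inv_mul_cancel (by norm_num) (by norm_num),
          one_mul]

lemma symmPart_mem_admissible {h ε : ℝ} (hh : 0 < h) {f : ℂ → ℂ} (hf : f ∈ admissible₀ h ε) :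
    symmPart f ∈ admissible h ε := by
  obtain ⟨hfH, hfn, hfb⟩ := hf
  refine ⟨(hfH.add hfH.symm).const_mul _, fun ω _ => congrFun (symm_symmPart f) ω, ?_, ?_⟩
  · refine le_trans (le_iInf₂ fun g hg => ?_) hfn
    exact (hardyNorm_le_eLpNorm ((hg.add hg.symm).const_mul 2⁻¹)).trans
      (eLpNorm_half_add_le hg.1.1 hg.symm.1.1 (eLpNorm_conj_comp_neg_univ hg.1.1))
  · refine le_trans (eLpNorm_half_add_le (hfH.aestronglyMeasurable_real hh _)
      (hfH.symm.aestronglyMeasurable_real hh _) ?_) hfb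
    have := eLpNorm_conj_comp_neg (s := Ioo (-1 : ℝ) 1) measurableSet_Ioo (by simp)
      (hfH.aestronglyMeasurable_real hh _)
    simpa [symm] using this

/-- Complexification: `f` is the sum of the symmetric part of `f` and `i` times that of `-i f`. -/
lemma eq_symmPart_add (f : ℂ → ℂ) (ω : ℂ) :
    f ω = symmPart f ω + Complex.I * symmPart (fun z => -Complex.I * f z) ω := by
  simp only [symmPart, symm, map_mul, map_neg, Complex.conj_I]
  linear_combination (2⁻¹ * (f ω - conj (f (-conj ω)))) * Complex.I_mul_I

lemma admissible_subset (h ε : ℝ) : admissible h ε ⊆ admissible₀ h ε :=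
  fun _ hf => ⟨hf.1, hf.2.2⟩

/-! ### The Cauchy kernel on horizontal lines -/

/-- The Cauchy kernel `ω ↦ 1 / (ω - a)` with real pole `a`, on the line `Im ω = t`. -/
noncomputable def cauchyKernel (a t : ℝ) : ℝ → ℂ := fun x => ((x : ℂ) + t * Complex.I - a)⁻¹

lemma line_sub_ne_zero (a : ℝ) {t : ℝ} (ht : t ≠ 0) (x : ℝ) :
    (x : ℂ) + t * Complex.I - a ≠ 0 := fun h0 => ht (by simpa using congrArg Complex.im h0)

lemma normSq_line_sub (a t x : ℝ) :
    Complex.normSq ((x : ℂ) + t * Complex.I - a) = (x - a) ^ 2 + t ^ 2 := by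
  simp [Complex.normSq_apply]
  ring

lemma norm_cauchyKernel (a t x : ℝ) :
    ‖cauchyKernel a t x‖ = (√((x - a) ^ 2 + t ^ 2))⁻¹ := by
  rw [cauchyKernel, norm_inv, Complex.norm_def, normSq_line_sub]

lemma continuous_cauchyKernel (a : ℝ) {t : ℝ} (ht : t ≠ 0) : Continuous (cauchyKernel a t) :=
  Continuous.inv₀ (by fun_prop) (line_sub_ne_zero a ht)

lemma norm_cauchyKernel_le (a : ℝ) {s t : ℝ} (hs : s ≠ 0) (hst : |s| ≤ |t|) (x : ℝ) :
    ‖cauchyKernel a t x‖ ≤ ‖cauchyKernel a s x‖ := by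
  rw [norm_cauchyKernel, norm_cauchyKernel]
  have : s ^ 2 ≤ t ^ 2 := sq_le_sq.2 hst
  gcongr

lemma integrable_inv_sq_add_sq (a : ℝ) {t : ℝ} (ht : t ≠ 0) :
    Integrable fun x : ℝ => ((x - a) ^ 2 + t ^ 2)⁻¹ := by
  have h1 : Integrable fun x : ℝ => (t ^ 2)⁻¹ * (1 + (x / t) ^ 2)⁻¹ :=
    ((integrable_comp_div_iff _ ht).2 integrable_inv_one_add_sq).const_mul _
  refine (h1.comp_sub_right a).congr (ae_of_all _ fun x => ?_)
  simp only
  rw [← mul_inv]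
  congr 1
  field_simp
  ring

lemma integral_inv_sq_add_sq (a : ℝ) {t : ℝ} (ht : t ≠ 0) :
    ∫ x : ℝ, ((x - a) ^ 2 + t ^ 2)⁻¹ = Real.pi / |t| := by
  have h1 : ∀ x : ℝ, ((x - a) ^ 2 + t ^ 2)⁻¹ = (t ^ 2)⁻¹ * (1 + ((x - a) / t) ^ 2)⁻¹ := by
    intro x
    rw [← mul_inv]
    congr 1
    field_simp
    ring
  simp_rw [h1]
  rw [integral_const_mul, integral_sub_right_eq_self (fun x : ℝ => (1 + (x / t) ^ 2)⁻¹) a,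
    Measure.integral_comp_div (fun x : ℝ => (1 + x ^ 2)⁻¹) t, integral_univ_inv_one_add_sq,
    smul_eq_mul, ← sq_abs t]
  have : |t| ≠ 0 := abs_ne_zero.2 ht
  field_simp

lemma eLpNorm_two_eq_lintegral {α : Type*} [MeasurableSpace α] (f : α → ℂ) (μ : Measure α) :
    eLpNorm f 2 μ = (∫⁻ x, ‖f x‖ₑ ^ 2 ∂μ) ^ (1 / 2 : ℝ) := by
  rw [eLpNorm_eq_lintegral_rpow_enorm_toReal (by norm_num) (by norm_num)]
  simp

lemma eLpNorm_cauchyKernel (a : ℝ) {t : ℝ} (ht : t ≠ 0) :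
    eLpNorm (cauchyKernel a t) 2 volume = ENNReal.ofReal (Real.pi / |t|) ^ (1 / 2 : ℝ) := by
  rw [eLpNorm_two_eq_lintegral, ← integral_inv_sq_add_sq a ht,
    ofReal_integral_eq_lintegral_ofReal (integrable_inv_sq_add_sq a ht)
      (ae_of_all _ fun x => by positivity)]
  congr 2
  funext x
  rw [← ofReal_norm, ← ENNReal.ofReal_pow (norm_nonneg _), norm_cauchyKernel, inv_pow,
    Real.sq_sqrt (by positivity)]

lemma memLp_cauchyKernel (a : ℝ) {t : ℝ} (ht : t ≠ 0) : MemLp (cauchyKernel a t) 2 volume := by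
  refine ⟨(continuous_cauchyKernel a ht).aestronglyMeasurable, ?_⟩
  rw [eLpNorm_cauchyKernel a ht]
  exact ENNReal.rpow_lt_top_of_nonneg (by norm_num) ENNReal.ofReal_ne_top

lemma MemHardy.memLp_line {h y : ℝ} {f : ℂ → ℂ} (hf : MemHardy h f) (hy : -h < y) :
    MemLp (fun x : ℝ => f (x + y * Complex.I)) 2 volume := by
  obtain ⟨M, hM, hle⟩ := hf.exists_bound
  exact ⟨hf.aestronglyMeasurable_line hy _, (hle y hy).trans_lt hM.lt_top⟩

/-- The Cauchy–Schwarz inequality for the bilinear pairing on `L²`. -/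
lemma eLpNorm_one_mul_le {α : Type*} [MeasurableSpace α] {μ : Measure α} {f g : α → ℂ}
    (hf : AEStronglyMeasurable f μ) (hg : AEStronglyMeasurable g μ) :
    eLpNorm (fun x => f x * g x) 1 μ ≤ eLpNorm f 2 μ * eLpNorm g 2 μ := by
  have h := eLpNorm_smul_le_mul_eLpNorm (p := 2) (q := 2) (r := 1) hg hf
  exact h

lemma enorm_integral_mul_le {α : Type*} [MeasurableSpace α] {μ : Measure α} {f g : α → ℂ}
    (hf : AEStronglyMeasurable f μ) (hg : AEStronglyMeasurable g μ) :
    ‖∫ x, f x * g x ∂μ‖ₑ ≤ eLpNorm f 2 μ * eLpNorm g 2 μ :=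
  (enorm_integral_le_lintegral_enorm _).trans
    (eLpNorm_one_eq_lintegral_enorm.symm.trans_le (eLpNorm_one_mul_le hf hg))

/-! ### Passing to the limit in pairings of bounded sequences in `L²` -/

/-- If `fₙ → g` almost everywhere with `fₙ` bounded in `L²`, and `kₙ → k` pointwise with `kₙ`
dominated by one `L²` function `w`, then the pairings converge. The products `fₙ kₙ` need not be
dominated by an integrable function; they inherit uniform integrability and tightness from `w`
by the Cauchy–Schwarz inequality, and the Vitali convergence theorem applies. -/
lemma tendsto_integral_mul_of_bounded_of_dominated {α : Type*} [MeasurableSpace α]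
    {μ : Measure α} {f k : ℕ → α → ℂ} {g κ w : α → ℂ} {M : ℝ≥0∞} (hM : M ≠ ∞)
    (hf : ∀ n, AEStronglyMeasurable (f n) μ) (hfM : ∀ n, eLpNorm (f n) 2 μ ≤ M)
    (hg : MemLp g 2 μ) (hfg : ∀ᵐ x ∂μ, Tendsto (fun n => f n x) atTop (𝓝 (g x)))
    (hk : ∀ n, AEStronglyMeasurable (k n) μ) (hw : MemLp w 2 μ)
    (hkw : ∀ n x, ‖k n x‖ ≤ ‖w x‖)
    (hkκ : ∀ x, Tendsto (fun n => k n x) atTop (𝓝 (κ x))) :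
    Tendsto (fun n => ∫ x, f n x * k n x ∂μ) atTop (𝓝 (∫ x, g x * κ x ∂μ)) := by
  have hκ : MemLp κ 2 μ :=
    hw.mono (aestronglyMeasurable_of_tendsto_ae atTop hk (ae_of_all _ hkκ))
      (ae_of_all _ fun x => le_of_tendsto (hkκ x).norm (Eventually.of_forall fun n => hkw n x))
  have hfL : ∀ n, MemLp (f n) 2 μ := fun n => ⟨hf n, (hfM n).trans_lt hM.lt_top⟩
  have hkL : ∀ n, MemLp (k n) 2 μ := fun n => hw.mono (hk n) (ae_of_all _ (hkw n))
  have hgκ : Integrable (fun x => g x * κ x) μ := hg.integrable_mul hκ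
  have hbound : ∀ n (s : Set α), MeasurableSet s →
      eLpNorm (s.indicator fun x => f n x * k n x) 1 μ ≤ M * eLpNorm (s.indicator w) 2 μ := by
    intro n s hs
    calc eLpNorm (s.indicator fun x => f n x * k n x) 1 μ
        ≤ eLpNorm (fun x => f n x * s.indicator w x) 1 μ := by
          refine eLpNorm_mono fun x => ?_
          by_cases hx : x ∈ s
          · simpa [hx] using mul_le_mul_of_nonneg_left (hkw n x) (norm_nonneg (f n x))
          · simp [hx]
      _ ≤ eLpNorm (f n) 2 μ * eLpNorm (s.indicator w) 2 μ :=
          eLpNorm_one_mul_le (hf n) (hw.1.indicator hs)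
      _ ≤ M * eLpNorm (s.indicator w) 2 μ := by gcongr; exact hfM n
  refine tendsto_integral_of_L1' _ hgκ.1
    (Eventually.of_forall fun n => (hfL n).integrable_mul (hkL n)) ?_
  refine tendsto_Lp_of_tendsto_ae le_rfl ENNReal.one_ne_top (fun n => (hf n).mul (hk n))
    (memLp_one_iff_integrable.2 hgκ) (fun ε hε => ?_) (fun ε hε => ?_) ?_
  · have hε' : 0 < ε / (M.toReal + 1) := by positivity
    obtain ⟨δ, hδ, H⟩ := hw.eLpNorm_indicator_le (by norm_num) (by norm_num) hε'
    refine ⟨δ, hδ, fun n s hs hμs => (hbound n s hs).trans ?_⟩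
    calc M * eLpNorm (s.indicator w) 2 μ
        ≤ ENNReal.ofReal M.toReal * ENNReal.ofReal (ε / (M.toReal + 1)) := by
          rw [ENNReal.ofReal_toReal hM]
          gcongr
          exact H s hs hμs
      _ ≤ ENNReal.ofReal ε := by
          rw [← ENNReal.ofReal_mul ENNReal.toReal_nonneg]
          refine ENNReal.ofReal_le_ofReal ?_
          rw [mul_div_assoc', div_le_iff₀ (by positivity)]
          nlinarith
  · have hε' : (ε : ℝ≥0∞) / (M + 1) ≠ 0 :=
      ENNReal.div_ne_zero.2 ⟨by simpa using hε.ne', by simpa using hM⟩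
    obtain ⟨s, hs, hμs, H⟩ := hw.exists_eLpNorm_indicator_compl_lt (by norm_num) hε'
    refine ⟨s, hμs.ne, fun n => (hbound n _ hs.compl).trans ?_⟩
    calc M * eLpNorm (sᶜ.indicator w) 2 μ ≤ (M + 1) * (ε / (M + 1)) := by
          gcongr
          exact le_self_add
      _ ≤ ε := ENNReal.mul_div_le
  · filter_upwards [hfg] with x hx using hx.mul (hkκ x)

/-! ### Cauchy's theorem on a strip -/

/-- The square integral of `f` over the strip `y ≤ Im ω ≤ Y` is finite, so there are arbitrarily
distant vertical segments, symmetric about the imaginary axis, on which the square integral of `f`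
is at most one. -/
lemma MemHardy.exists_vertical_le {h y Y : ℝ} {f : ℂ → ℂ} (hf : MemHardy h f) (hy : -h < y)
    (N : ℝ) :
    ∃ R ≥ N, (∫⁻ t in Ioc y Y, ‖f (R + t * Complex.I)‖ₑ ^ 2) ≤ 1 ∧
      (∫⁻ t in Ioc y Y, ‖f ((-R : ℝ) + t * Complex.I)‖ₑ ^ 2) ≤ 1 := by
  obtain ⟨M, hM, hle⟩ := hf.exists_bound
  set G : ℝ → ℝ≥0∞ := fun x => ∫⁻ t in Ioc y Y, ‖f (x + t * Complex.I)‖ₑ ^ 2 with hG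
  have hmeas : AEMeasurable (fun p : ℝ × ℝ => ‖f (p.1 + p.2 * Complex.I)‖ₑ ^ 2)
      ((volume : Measure ℝ).prod (volume.restrict (Ioc y Y))) := by
    have hc : ContinuousOn (fun p : ℝ × ℝ => f (p.1 + p.2 * Complex.I)) (univ ×ˢ Ioc y Y) :=
      hf.1.continuousOn.comp (by fun_prop) fun p hp =>
        add_mul_I_mem_halfPlane (hy.trans hp.2.1) p.1
    have := hc.aestronglyMeasurable (μ := (volume : Measure ℝ).prod volume)
      (MeasurableSet.univ.prod measurableSet_Ioc)
    rw [← Measure.prod_restrict, Measure.restrict_univ] at this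
    exact this.enorm.pow_const 2
  have hGm : AEMeasurable G volume := hmeas.lintegral_prod_right'
  have hline : ∀ t ∈ Ioc y Y, ∫⁻ x : ℝ, ‖f (x + t * Complex.I)‖ₑ ^ 2 ≤ M ^ 2 := by
    intro t ht
    have := hle t (hy.trans ht.1)
    rw [eLpNorm_two_eq_lintegral] at this
    have h2 := ENNReal.rpow_le_rpow this (z := 2) (by norm_num)
    rw [← ENNReal.rpow_mul] at h2
    simpa using h2
  have hGfin : ∫⁻ x, G x ≠ ∞ := by
    rw [hG, lintegral_lintegral_swap hmeas]
    refine ne_top_of_le_ne_top ?_ (setLIntegral_mono' measurableSet_Ioc hline)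
    rw [setLIntegral_const, Real.volume_Ioc]
    exact ENNReal.mul_ne_top (ENNReal.pow_ne_top hM) ENNReal.ofReal_ne_top
  have hA : volume {x | 1 ≤ G x} ≠ ∞ :=
    ne_top_of_le_ne_top hGfin (by simpa using mul_meas_ge_le_lintegral₀ hGm 1)
  by_contra! hcon
  have hsub : Ici N ⊆ {x | 1 ≤ G x} ∪ Neg.neg ⁻¹' {x | 1 ≤ G x} := by
    intro R hR
    by_cases h1 : G R ≤ 1
    · exact Or.inr (hcon R hR h1).le
    · exact Or.inl (not_le.1 h1).le
  have hA' : volume (Neg.neg ⁻¹' {x | 1 ≤ G x}) ≠ ∞ := by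
    rwa [show (Neg.neg ⁻¹' {x | 1 ≤ G x} : Set ℝ) = -{x | 1 ≤ G x} from rfl, Measure.measure_neg]
  have htop : volume (Ici N) ≠ ∞ :=
    ne_top_of_le_ne_top (ENNReal.add_ne_top.2 ⟨hA, hA'⟩)
      ((measure_mono hsub).trans (measure_union_le _ _))
  exact htop Real.volume_Ici

/-- On a vertical segment at distance `d` from the pole, the integral of `f / (ω - a)` is
controlled by the square integral of `f`, through `s ≤ 1 + s²`. -/
lemma norm_integral_vertical_le {f v : ℂ → ℂ} {R y Y d : ℝ} (hyY : y ≤ Y) (hd : 0 < d)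
    (hv : ∀ t : ℝ, ‖v (R + t * Complex.I)‖ ≤ d⁻¹ * ‖f (R + t * Complex.I)‖)
    (hf : (∫⁻ t in Ioc y Y, ‖f (R + t * Complex.I)‖ₑ ^ 2) ≤ 1) :
    ‖∫ t in y..Y, v (R + t * Complex.I)‖ ≤ d⁻¹ * (Y - y + 1) := by
  have hd' : 0 ≤ d⁻¹ := by positivity
  have key : ‖∫ t in y..Y, v (R + t * Complex.I)‖ₑ ≤ ENNReal.ofReal (d⁻¹ * (Y - y + 1)) := by
    rw [intervalIntegral.integral_of_le hyY]
    calc ‖∫ t in Ioc y Y, v (R + t * Complex.I)‖ₑ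
        ≤ ∫⁻ t in Ioc y Y, ‖v (R + t * Complex.I)‖ₑ := enorm_integral_le_lintegral_enorm _
      _ ≤ ∫⁻ t in Ioc y Y, ENNReal.ofReal d⁻¹ * (1 + ‖f (R + t * Complex.I)‖ₑ ^ 2) := by
          refine lintegral_mono fun t => ?_
          have h1 : ‖f (R + t * Complex.I)‖ ≤ 1 + ‖f (R + t * Complex.I)‖ ^ 2 := by
            nlinarith [sq_nonneg (‖f (R + t * Complex.I)‖ - 1)]
          have h2 : ‖v (R + t * Complex.I)‖ ≤ d⁻¹ * (1 + ‖f (R + t * Complex.I)‖ ^ 2) :=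
            (hv t).trans (mul_le_mul_of_nonneg_left h1 hd')
          calc ‖v (R + t * Complex.I)‖ₑ
              ≤ ENNReal.ofReal (d⁻¹ * (1 + ‖f (R + t * Complex.I)‖ ^ 2)) := by
                rw [← ofReal_norm]
                exact ENNReal.ofReal_le_ofReal h2
            _ = _ := by
                rw [ENNReal.ofReal_mul hd', ENNReal.ofReal_add zero_le_one (by positivity),
                  ENNReal.ofReal_one, ENNReal.ofReal_pow (norm_nonneg _), ofReal_norm]
      _ = ENNReal.ofReal d⁻¹ *
            (ENNReal.ofReal (Y - y) + ∫⁻ t in Ioc y Y, ‖f (R + t * Complex.I)‖ₑ ^ 2) := by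
          rw [lintegral_const_mul' _ _ ENNReal.ofReal_ne_top, lintegral_add_left measurable_const,
            setLIntegral_const, Real.volume_Ioc, one_mul]
      _ ≤ ENNReal.ofReal d⁻¹ * (ENNReal.ofReal (Y - y) + 1) := by gcongr
      _ = ENNReal.ofReal (d⁻¹ * (Y - y + 1)) := by
          rw [ENNReal.ofReal_mul hd', ENNReal.ofReal_add (by linarith) zero_le_one,
            ENNReal.ofReal_one]
  rw [← ofReal_norm] at key
  have : 0 ≤ Y - y + 1 := by linarith
  exact (ENNReal.ofReal_le_ofReal_iff (by positivity)).1 key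

/-- Integrals of a holomorphic function over two horizontal lines agree as soon as, along some
sequence of abscissas tending to infinity, the integrals over the connecting vertical segments
tend to zero. -/
lemma integral_line_eq_of_tendsto_vertical {h y Y : ℝ} {v : ℂ → ℂ}
    (hv : DifferentiableOn ℂ v (halfPlane h)) (hy : -h < y) (hY : -h < Y)
    (hiy : Integrable fun x : ℝ => v (x + y * Complex.I))
    (hiY : Integrable fun x : ℝ => v (x + Y * Complex.I))
    {R : ℕ → ℝ} (hR : Tendsto R atTop atTop)
    (hr : Tendsto (fun n => ∫ t in y..Y, v (R n + t * Complex.I)) atTop (𝓝 0))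
    (hl : Tendsto (fun n => ∫ t in y..Y, v ((-R n : ℝ) + t * Complex.I)) atTop (𝓝 0)) :
    ∫ x : ℝ, v (x + y * Complex.I) = ∫ x : ℝ, v (x + Y * Complex.I) := by
  have hRn : Tendsto (fun n => -R n) atTop atBot := tendsto_neg_atTop_atBot.comp hR
  have h1 := intervalIntegral_tendsto_integral hiy hRn hR
  have h2 := intervalIntegral_tendsto_integral hiY hRn hR
  have h3 := (((h1.sub h2).add (hr.const_mul Complex.I)).sub (hl.const_mul Complex.I))
  have h0 : ∀ n, ((∫ x in (-R n)..(R n), v (x + y * Complex.I)) -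
      ∫ x in (-R n)..(R n), v (x + Y * Complex.I)) +
      Complex.I * (∫ t in y..Y, v (R n + t * Complex.I)) -
      Complex.I * (∫ t in y..Y, v ((-R n : ℝ) + t * Complex.I)) = 0 := by
    intro n
    have := Complex.integral_boundary_rect_eq_zero_of_differentiableOn v
      ((-R n : ℝ) + y * Complex.I) (R n + Y * Complex.I) (hv.mono fun ω hω => ?_)
    · simpa using this
    · have him : ω.im ∈ uIcc y Y := by simpa using hω.2
      exact (lt_min hy hY).trans_le him.1
  simp only [h0] at h3
  have := tendsto_nhds_unique h3 tendsto_const_nhds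
  simp only [mul_zero, add_zero, sub_zero] at this
  exact sub_eq_zero.1 this

/-! ### The Cauchy formula on the boundary line -/

/-- For `f` in the Hardy class vanishing at the real point `a`, the quotient `f / (ω - a)` is
holomorphic, so its integrals over the lines below and above `a` agree; the latter are
`O(Y ^ (-1/2))` at height `Y`, hence all vanish. -/
lemma MemHardy.integral_mul_cauchyKernel_eq_zero {h a y : ℝ} {f : ℂ → ℂ} (hf : MemHardy h f)
    (ha : f a = 0) (hy : -h < y) (hy0 : y < 0) :
    ∫ x : ℝ, f (x + y * Complex.I) * cauchyKernel a y x = 0 := by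
  have haH : halfPlane h ∈ 𝓝 (a : ℂ) :=
    (isOpen_halfPlane h).mem_nhds (by
      simp only [halfPlane, mem_ofPred_eq, Complex.ofReal_im]
      linarith)
  set v : ℂ → ℂ := dslope f a with hvdef
  have hv : DifferentiableOn ℂ v (halfPlane h) := (Complex.differentiableOn_dslope haH).2 hf.1
  have hvne : ∀ ω : ℂ, ω ≠ a → v ω = f ω * (ω - a)⁻¹ := by
    intro ω hω
    rw [hvdef, dslope_of_ne _ hω, slope_def_field, ha, sub_zero, div_eq_mul_inv]
  have hvline : ∀ t : ℝ, t ≠ 0 → ∀ x : ℝ,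
      v (x + t * Complex.I) = f (x + t * Complex.I) * cauchyKernel a t x := fun t ht x =>
    hvne _ (sub_ne_zero.1 (line_sub_ne_zero a ht x))
  have hint : ∀ t : ℝ, -h < t → t ≠ 0 → Integrable fun x : ℝ => v (x + t * Complex.I) := by
    intro t ht ht0
    simp only [hvline t ht0]
    exact (hf.memLp_line ht).integrable_mul (memLp_cauchyKernel a ht0)
  -- The integral does not depend on the line: the vertical sides of the rectangles are
  -- segments on which the square integral of `f` is at most one.
  have heq : ∀ Y : ℝ, 0 < Y →
      ∫ x : ℝ, v (x + y * Complex.I) = ∫ x : ℝ, v (x + Y * Complex.I) := by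
    intro Y hY
    choose R hRn hRr hRl using fun n : ℕ =>
      hf.exists_vertical_le (Y := Y) hy ((n : ℝ) + 1 + |a|)
    have hvert : ∀ (n : ℕ) (r : ℝ), |r| = R n → ∀ t : ℝ, ‖v (r + t * Complex.I)‖ ≤
        ((n : ℝ) + 1)⁻¹ * ‖f (r + t * Complex.I)‖ := by
      intro n r hr t
      have hd : (n : ℝ) + 1 ≤ ‖(r : ℂ) + t * Complex.I - a‖ := by
        have h1 : |r - a| ≤ ‖(r : ℂ) + t * Complex.I - a‖ := by
          simpa using Complex.abs_re_le_norm ((r : ℂ) + t * Complex.I - a)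
        have h2 := abs_sub_abs_le_abs_sub r a
        linarith [hRn n]
      have hne : (r : ℂ) + t * Complex.I ≠ a := by
        intro h0
        rw [h0, sub_self, norm_zero] at hd
        linarith [n.cast_nonneg (α := ℝ)]
      rw [hvne _ hne, norm_mul, norm_inv, mul_comm]
      gcongr
    have hRpos : ∀ n, 0 ≤ R n := fun n => by
      linarith [hRn n, abs_nonneg a, n.cast_nonneg (α := ℝ)]
    have hlim : Tendsto (fun n : ℕ => ((n : ℝ) + 1)⁻¹ * (Y - y + 1)) atTop (𝓝 0) := by
      simpa using (tendsto_one_div_add_atTop_nhds_zero_nat (𝕜 := ℝ)).mul_const (Y - y + 1)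
    refine integral_line_eq_of_tendsto_vertical hv hy (by linarith) (hint y hy hy0.ne)
      (hint Y (by linarith) hY.ne') (R := R) ?_ ?_ ?_
    · refine tendsto_atTop_mono (fun n => ?_) tendsto_natCast_atTop_atTop
      linarith [hRn n, abs_nonneg a]
    · exact squeeze_zero_norm (fun n => norm_integral_vertical_le (by linarith) (by positivity)
        (hvert n (R n) (abs_of_nonneg (hRpos n))) (hRr n)) hlim
    · exact squeeze_zero_norm (fun n => norm_integral_vertical_le (by linarith) (by positivity)
        (hvert n (-R n) (by rw [abs_neg, abs_of_nonneg (hRpos n)])) (hRl n)) hlim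
  obtain ⟨M, hM, hle⟩ := hf.exists_bound
  have hbound : ∀ Y : ℝ, 0 < Y → ‖∫ x : ℝ, v (x + y * Complex.I)‖ₑ ≤
      M * ENNReal.ofReal (Real.pi / Y) ^ (1 / 2 : ℝ) := by
    intro Y hY
    rw [heq Y hY]
    simp only [hvline Y hY.ne']
    refine (enorm_integral_mul_le (hf.aestronglyMeasurable_line (by linarith) _)
      (continuous_cauchyKernel a hY.ne').aestronglyMeasurable).trans ?_
    rw [eLpNorm_cauchyKernel a hY.ne', abs_of_pos hY]
    gcongr
    exact hle Y (by linarith)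
  have hlim : Tendsto (fun Y : ℝ => M * ENNReal.ofReal (Real.pi / Y) ^ (1 / 2 : ℝ)) atTop
      (𝓝 0) := by
    have h1 : Tendsto (fun Y : ℝ => ENNReal.ofReal (Real.pi / Y)) atTop (𝓝 0) := by
      simpa using ENNReal.tendsto_ofReal (tendsto_const_nhds.div_atTop tendsto_id)
    have h2 := (ENNReal.continuous_rpow_const (y := (1 / 2 : ℝ))).tendsto 0 |>.comp h1
    have h3 := ENNReal.Tendsto.const_mul h2 (Or.inr hM)
    simpa using h3
  have hzero : ‖∫ x : ℝ, v (x + y * Complex.I)‖ₑ ≤ 0 :=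
    ge_of_tendsto hlim ((eventually_gt_atTop 0).mono hbound)
  simp only [← hvline y hy0.ne]
  simpa using hzero

/-- The vanishing of the Cauchy integral persists for the boundary data. -/
lemma HasBoundaryData.integral_mul_cauchyKernel_eq_zero {h a : ℝ} (hh : 0 < h) {f : ℂ → ℂ}
    {g : ℝ → ℂ} (hf : MemHardy h f) (hg : HasBoundaryData h f g) (ha : f a = 0) :
    ∫ x : ℝ, g x * cauchyKernel a (-h) x = 0 := by
  obtain ⟨M, hM, hle⟩ := hf.exists_bound
  -- The lines approach the boundary from within the strip `-h < Im ω ≤ -h / 2`.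
  set y : ℕ → ℝ := fun n => -h + h / 2 * (1 / ((n : ℝ) + 1)) with hydef
  have hfrac : ∀ n : ℕ, 0 < 1 / ((n : ℝ) + 1) ∧ 1 / ((n : ℝ) + 1) ≤ 1 := fun n =>
    ⟨by positivity, by
      rw [div_le_one (by positivity)]
      linarith [n.cast_nonneg (α := ℝ)]⟩
  have hy : ∀ n, -h < y n := fun n => by
    have := hfrac n
    simp only [hydef]
    nlinarith
  have hy2 : ∀ n, y n ≤ -(h / 2) := fun n => by
    have := hfrac n
    simp only [hydef]
    nlinarith
  have hy0 : ∀ n, y n < 0 := fun n => by linarith [hy2 n]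
  have hylim : Tendsto y atTop (𝓝 (-h)) := by
    simpa [hydef] using (tendsto_one_div_add_atTop_nhds_zero_nat (𝕜 := ℝ)).const_mul (h / 2)
      |>.const_add (-h)
  have hylim' : Tendsto y atTop (𝓝[>] (-h)) :=
    tendsto_nhdsWithin_iff.2 ⟨hylim, Eventually.of_forall hy⟩
  have hlim := tendsto_integral_mul_of_bounded_of_dominated (μ := (volume : Measure ℝ)) hM
    (f := fun n x => f (x + y n * Complex.I)) (k := fun n => cauchyKernel a (y n))
    (g := g) (κ := cauchyKernel a (-h)) (w := cauchyKernel a (h / 2))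
    (fun n => hf.aestronglyMeasurable_line (hy n) _) (fun n => hle _ (hy n)) hg.1
    (by filter_upwards [hg.2] with x hx using hx.comp hylim')
    (fun n => (continuous_cauchyKernel a (hy0 n).ne).aestronglyMeasurable)
    (memLp_cauchyKernel a (by positivity))
    (fun n x => norm_cauchyKernel_le a (by positivity)
      (by rw [abs_of_pos (by positivity), abs_of_neg (hy0 n)]; linarith [hy2 n]) x)
    (fun x => by
      refine Tendsto.inv₀ ?_ (line_sub_ne_zero a (by linarith) x)
      exact ((((Complex.continuous_ofReal.tendsto _).comp hylim).mul_const _).const_add _).sub_const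
        _)
  simp only [hf.integral_mul_cauchyKernel_eq_zero ha (hy _) (hy0 _)] at hlim
  exact tendsto_nhds_unique hlim tendsto_const_nhds

/-- The function `ω ↦ 1 / (ω - (a - ib))`, with its pole below the half-plane when `b > h`. -/
noncomputable def simplePole (a b : ℝ) : ℂ → ℂ := fun ω => (ω + b * Complex.I - a)⁻¹

lemma simplePole_line (a b x y : ℝ) :
    simplePole a b (x + y * Complex.I) = cauchyKernel a (y + b) x := by
  simp only [simplePole, cauchyKernel]
  congr 2
  push_cast
  ring

lemma memHardy_simplePole (a : ℝ) {b h : ℝ} (hb : h < b) : MemHardy h (simplePole a b) := by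
  refine memHardy_of_forall_le (fun ω hω => ?_)
    (memLp_cauchyKernel a (t := b - h) (by linarith)).2.ne fun y hy => ?_
  · refine (DifferentiableAt.inv (by fun_prop) fun h0 => ?_).differentiableWithinAt
    have h1 : ω.im + b = 0 := by simpa using congrArg Complex.im h0
    have h2 : -h < ω.im := hω
    linarith
  · simp only [simplePole_line]
    refine eLpNorm_mono (norm_cauchyKernel_le a (by linarith) ?_)
    rw [abs_of_pos (by linarith), abs_of_pos (by linarith)]
    linarith

lemma hasBoundaryData_simplePole (a : ℝ) {b h : ℝ} (hb : h < b) :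
    HasBoundaryData h (simplePole a b) (cauchyKernel a (b - h)) := by
  refine ⟨memLp_cauchyKernel a (by linarith), ae_of_all _ fun x => ?_⟩
  have hc : Tendsto (fun y : ℝ => cauchyKernel a (y + b) x) (𝓝 (-h))
      (𝓝 (cauchyKernel a (-h + b) x)) := by
    refine Tendsto.inv₀ ?_ (line_sub_ne_zero a (by linarith) x)
    exact Continuous.tendsto (by fun_prop) _
  simp only [simplePole_line]
  rw [show b - h = -h + b by ring]
  exact hc.mono_left nhdsWithin_le_nhds

/-- The Cauchy formula with boundary data. Subtracting from `f` the multiple of the simple pole at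
the reflection `a - 2ih` of `a` that has the same value at `a` reduces it to the vanishing case;
the pole itself contributes a Poisson integral. -/
lemma HasBoundaryData.integral_mul_cauchyKernel {h : ℝ} (hh : 0 < h) (a : ℝ) {f : ℂ → ℂ}
    {g : ℝ → ℂ} (hf : MemHardy h f) (hg : HasBoundaryData h f g) :
    ∫ x : ℝ, g x * cauchyKernel a (-h) x = 2 * Real.pi * Complex.I * f a := by
  have hb : h < 2 * h := by linarith
  set c : ℂ := -(f a * (2 * h * Complex.I)) with hc
  have hh0 : (h : ℂ) ≠ 0 := by exact_mod_cast hh.ne'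
  have hzero := HasBoundaryData.integral_mul_cauchyKernel_eq_zero hh (a := a)
    (hf.add ((memHardy_simplePole a hb).const_mul c))
    (hg.add ((hasBoundaryData_simplePole a hb).const_mul c)) (by
      simp only [hc, simplePole]
      push_cast
      rw [add_sub_cancel_left]
      field_simp [Complex.I_ne_zero]
      ring)
  have hK := memLp_cauchyKernel a (t := -h) (by linarith)
  have hK' := memLp_cauchyKernel a (t := h) hh.ne'
  have hprod : ∀ x, cauchyKernel a h x * cauchyKernel a (-h) x =
      ((((x - a) ^ 2 + h ^ 2)⁻¹ : ℝ) : ℂ) := by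
    intro x
    simp only [cauchyKernel]
    rw [← mul_inv]
    push_cast
    congr 1
    linear_combination (-(h : ℂ) ^ 2) * Complex.I_sq
  have hpole : ∫ x, cauchyKernel a h x * cauchyKernel a (-h) x = (Real.pi / h : ℂ) := by
    simp only [hprod]
    rw [integral_complex_ofReal, integral_inv_sq_add_sq a hh.ne', abs_of_pos hh]
    push_cast
    rfl
  have hsplit : ∀ x, (g x + c * cauchyKernel a (2 * h - h) x) * cauchyKernel a (-h) x =
      g x * cauchyKernel a (-h) x + c * (cauchyKernel a h x * cauchyKernel a (-h) x) := by
    intro x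
    rw [show 2 * h - h = h by ring]
    ring
  simp only [hsplit] at hzero
  have hi₁ : Integrable fun x => g x * cauchyKernel a (-h) x := hg.1.integrable_mul hK
  have hi₂ : Integrable fun x => c * (cauchyKernel a h x * cauchyKernel a (-h) x) :=
    (hK'.integrable_mul hK).const_mul c
  rw [integral_add hi₁ hi₂, integral_const_mul, hpole] at hzero
  rw [eq_neg_of_add_eq_zero_left hzero, hc]
  field_simp

/-! ### Finiteness and positivity of the suprema -/

/-- Point evaluation at a real point is controlled by the Hardy norm. -/
lemma exists_norm_le_of_hardyNorm_le_one {h : ℝ} (hh : 0 < h) (a : ℝ) :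
    ∃ C : ℝ, ∀ f, MemHardy h f → hardyNorm h f ≤ 1 → ‖f a‖ ≤ C := by
  have hK := memLp_cauchyKernel a (t := -h) (by linarith)
  refine ⟨(2 * eLpNorm (cauchyKernel a (-h)) 2 volume).toReal, fun f hf hn => ?_⟩
  obtain ⟨g, hg, hg2⟩ := exists_hasBoundaryData_of_hardyNorm_lt
    (hn.trans_lt (by norm_num : (1 : ℝ≥0∞) < 2))
  have h1 : ‖2 * Real.pi * Complex.I * f a‖ₑ ≤ 2 * eLpNorm (cauchyKernel a (-h)) 2 volume := by
    rw [← hg.integral_mul_cauchyKernel hh a hf]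
    exact (enorm_integral_mul_le hg.1.1 hK.1).trans (by gcongr)
  have h2 : ‖2 * Real.pi * Complex.I * f a‖ ≤
      (2 * eLpNorm (cauchyKernel a (-h)) 2 volume).toReal := by
    have := ENNReal.toReal_mono (ENNReal.mul_ne_top (by norm_num) hK.2.ne) h1
    rwa [toReal_enorm] at this
  refine le_trans ?_ h2
  rw [norm_mul]
  refine le_mul_of_one_le_left (norm_nonneg _) ?_
  simp only [norm_mul, Complex.norm_ofNat, Complex.norm_real, Complex.norm_I, mul_one,
    Real.norm_eq_abs, abs_of_pos Real.pi_pos]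
  linarith [Real.pi_gt_three]

lemma bddAbove_admissible₀ {h : ℝ} (hh : 0 < h) (a ε : ℝ) :
    BddAbove ((fun f : ℂ → ℂ => ‖f a‖) '' admissible₀ h ε) := by
  obtain ⟨C, hC⟩ := exists_norm_le_of_hardyNorm_le_one hh a
  refine ⟨C, ?_⟩
  rintro _ ⟨f, hf, rfl⟩
  exact hC f hf.1 hf.2.1

lemma bddAbove_admissible {h : ℝ} (hh : 0 < h) (a ε : ℝ) :
    BddAbove ((fun f : ℂ → ℂ => ‖f a‖) '' admissible h ε) :=
  (bddAbove_admissible₀ hh a ε).mono (image_mono (admissible_subset h ε))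

/-- Small multiples of `i / (ω + 2ih)` are admissible, symmetric, and have no zeros. -/
lemma exists_admissible_ne_zero {h ε : ℝ} (hh : 0 < h) (hε : 0 < ε) (a : ℝ) :
    ∃ f ∈ admissible h ε, f a ≠ 0 := by
  have hb : h < 2 * h := by linarith
  have hK := memLp_cauchyKernel 0 (t := 2 * h - h) (by linarith)
  set N := eLpNorm (cauchyKernel 0 (2 * h - h)) 2 volume with hN
  set m : ℝ := min 1 ε with hm
  have hm0 : 0 < m := lt_min one_pos hε
  set c : ℝ := m / (N.toReal + 1) with hc
  have hc0 : 0 < c := by positivity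
  have hcN : ‖(c * Complex.I : ℂ)‖ₑ * N ≤ ENNReal.ofReal m := by
    rw [← ofReal_norm, ← ENNReal.ofReal_toReal (a := N) hK.2.ne, ← ENNReal.ofReal_mul (norm_nonneg _)]
    refine ENNReal.ofReal_le_ofReal ?_
    rw [norm_mul, Complex.norm_I, mul_one, Complex.norm_real, Real.norm_of_nonneg hc0.le, hc,
      div_mul_eq_mul_div, div_le_iff₀ (by positivity)]
    nlinarith [ENNReal.toReal_nonneg (a := N)]
  refine ⟨fun ω => (c * Complex.I) * simplePole 0 (2 * h) ω,
    ⟨(memHardy_simplePole 0 hb).const_mul _, fun ω _ => ?_, ?_, ?_⟩, ?_⟩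
  · simp only [symm, simplePole, map_mul, map_inv₀, map_add, map_sub, map_neg, Complex.conj_I,
      Complex.conj_ofReal, Complex.conj_conj]
    rw [show -ω + ((2 * h : ℝ) : ℂ) * -Complex.I - (0 : ℝ) =
      -(ω + ((2 * h : ℝ) : ℂ) * Complex.I - (0 : ℝ)) by push_cast; ring, inv_neg]
    ring
  · refine (hardyNorm_le_eLpNorm ((hasBoundaryData_simplePole 0 hb).const_mul _)).trans ?_
    refine (eLpNorm_const_smul_le (c := (c * Complex.I : ℂ))).trans (hcN.trans ?_)
    exact (ENNReal.ofReal_le_ofReal (min_le_left 1 ε)).trans_eq ENNReal.ofReal_one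
  · refine (eLpNorm_const_smul_le (c := (c * Complex.I : ℂ))).trans ?_
    refine le_trans ?_ (hcN.trans (ENNReal.ofReal_le_ofReal (min_le_right 1 ε)))
    gcongr
    refine (eLpNorm_mono_measure _ Measure.restrict_le_self).trans (eLpNorm_mono fun x => ?_)
    have := simplePole_line 0 (2 * h) x 0
    simp only [Complex.ofReal_zero, zero_mul, add_zero, zero_add] at this
    rw [this]
    refine norm_cauchyKernel_le 0 (by linarith) ?_ x
    rw [abs_of_pos (by linarith), abs_of_pos (by linarith)]
    linarith
  · have := line_sub_ne_zero 0 (t := 2 * h) (by linarith) a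
    exact mul_ne_zero (mul_ne_zero (by exact_mod_cast hc0.ne') Complex.I_ne_zero)
      (inv_ne_zero this)

lemma D_pos {h ε : ℝ} (hh : 0 < h) (hε : 0 < ε) (a : ℝ) : 0 < D a h ε := by
  obtain ⟨f, hf, hfa⟩ := exists_admissible_ne_zero hh hε a
  exact (norm_pos_iff.2 hfa).trans_le
    (le_csSup (bddAbove_admissible hh a ε) (mem_image_of_mem _ hf))

/-! ### Comparison of the two suprema -/

lemma D_le_D₀ {h ε : ℝ} (hh : 0 < h) (hε : 0 < ε) (a : ℝ) : D a h ε ≤ D₀ a h ε := by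
  obtain ⟨f, hf, -⟩ := exists_admissible_ne_zero hh hε a
  exact csSup_le_csSup (bddAbove_admissible₀ hh a ε) ⟨_, mem_image_of_mem _ hf⟩
    (image_mono (admissible_subset h ε))

lemma D₀_le_two_mul_D {h ε : ℝ} (hh : 0 < h) (hε : 0 < ε) (a : ℝ) :
    D₀ a h ε ≤ 2 * D a h ε := by
  obtain ⟨f₀, hf₀, -⟩ := exists_admissible_ne_zero hh hε a
  refine csSup_le ⟨_, mem_image_of_mem _ (admissible_subset h ε hf₀)⟩ ?_
  rintro _ ⟨f, hf, rfl⟩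
  have hle : ∀ u ∈ admissible h ε, ‖u a‖ ≤ D a h ε := fun u hu =>
    le_csSup (bddAbove_admissible hh a ε) (mem_image_of_mem _ hu)
  have h1 := hle _ (symmPart_mem_admissible hh hf)
  have h2 := hle _ (symmPart_mem_admissible hh
    (const_mul_mem_admissible₀ hf (c := -Complex.I) (by simp)))
  have h3 : ‖f a‖ ≤ ‖symmPart f a‖ + ‖symmPart (fun z => -Complex.I * f z) a‖ := by
    calc ‖f a‖ = ‖symmPart f a + Complex.I * symmPart (fun z => -Complex.I * f z) a‖ := by
          rw [← eq_symmPart_add]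
      _ ≤ _ := (norm_add_le _ _).trans_eq (by rw [norm_mul, Complex.norm_I, one_mul])
  simp only
  linarith

/-! ### Equality of the exponents -/

/-- Two positive error bounds within a factor `2` of each other have asymptotically equal
logarithmic slopes, because `|ln ε| → ∞`. -/
lemma tendsto_log_div_log_sub {E F : ℝ → ℝ} (hE : ∀ ε, 0 < ε → 0 < E ε)
    (hEF : ∀ ε, 0 < ε → E ε ≤ F ε) (hFE : ∀ ε, 0 < ε → F ε ≤ 2 * E ε) :
    Tendsto (fun ε => Real.log (F ε) / Real.log ε - Real.log (E ε) / Real.log ε) (𝓝[>] 0)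
      (𝓝 0) := by
  have hlim : Tendsto (fun ε => Real.log 2 / |Real.log ε|) (𝓝[>] 0) (𝓝 0) :=
    tendsto_const_nhds.div_atTop (tendsto_abs_atBot_atTop.comp Real.tendsto_log_nhdsGT_zero)
  refine squeeze_zero_norm' (eventually_mem_nhdsWithin.mono fun ε (hε : 0 < ε) => ?_) hlim
  have hE0 := hE ε hε
  have h1 := Real.log_le_log hE0 (hEF ε hε)
  have h2 := Real.log_le_log (hE0.trans_le (hEF ε hε)) (hFE ε hε)
  rw [Real.log_mul two_ne_zero hE0.ne'] at h2
  rw [← sub_div, norm_div, Real.norm_eq_abs, Real.norm_eq_abs, abs_of_nonneg (by linarith)]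
  gcongr
  linarith

lemma liminf_coe_le_of_tendsto_sub {l : Filter ℝ} [l.NeBot] {u v : ℝ → ℝ}
    (huv : Tendsto (fun ε => v ε - u ε) l (𝓝 0)) :
    liminf (fun ε => (u ε : EReal)) l ≤ liminf (fun ε => (v ε : EReal)) l := by
  have h0 : liminf (fun ε => ((v ε - u ε : ℝ) : EReal)) l = 0 :=
    ((continuous_coe_real_ereal.tendsto 0).comp huv).liminf_eq
  calc liminf (fun ε => (u ε : EReal)) l
      = liminf (fun ε => (u ε : EReal)) l + liminf (fun ε => ((v ε - u ε : ℝ) : EReal)) l := by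
        rw [h0, add_zero]
    _ ≤ liminf ((fun ε => (u ε : EReal)) + fun ε => ((v ε - u ε : ℝ) : EReal)) l :=
        EReal.le_liminf_add
    _ = liminf (fun ε => (v ε : EReal)) l := by
        refine congrArg (liminf · l) (funext fun ε => ?_)
        rw [Pi.add_apply, ← EReal.coe_add, add_sub_cancel]

end HardyExtrapolation

theorem mainTheorem7 (h ω₀ : ℝ) (hh : 0 < h) (hω₀ : 1 < ω₀) :
    (∀ ε : ℝ, 0 < ε →
      -- the suprema are finite and positive
      BddAbove ((fun f : ℂ → ℂ => ‖f ω₀‖) '' HardyExtrapolation.admissible₀ h ε) ∧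
      BddAbove ((fun f : ℂ → ℂ => ‖f ω₀‖) '' HardyExtrapolation.admissible h ε) ∧
      0 < HardyExtrapolation.D ω₀ h ε ∧
      -- the two-sided comparison
      1 / 2 * HardyExtrapolation.D₀ ω₀ h ε ≤ HardyExtrapolation.D ω₀ h ε ∧
      HardyExtrapolation.D ω₀ h ε ≤ HardyExtrapolation.D₀ ω₀ h ε) ∧
    -- equality of the power-law exponents (as lower limits)
    HardyExtrapolation.powerLawExponent (HardyExtrapolation.D ω₀ h) =
      HardyExtrapolation.powerLawExponent (HardyExtrapolation.D₀ ω₀ h) ∧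
    -- one exponent is attained as a genuine limit if and only if the other one is
    (∀ γ : ℝ,
      Tendsto (fun ε : ℝ => Real.log (HardyExtrapolation.D ω₀ h ε) / Real.log ε) (𝓝[>] 0) (𝓝 γ) ↔
      Tendsto (fun ε : ℝ => Real.log (HardyExtrapolation.D₀ ω₀ h ε) / Real.log ε) (𝓝[>] 0)
        (𝓝 γ)) := by
  have hsub := HardyExtrapolation.tendsto_log_div_log_sub
    (fun ε hε => HardyExtrapolation.D_pos hh hε ω₀)
    (fun ε hε => HardyExtrapolation.D_le_D₀ hh hε ω₀)
    (fun ε hε => HardyExtrapolation.D₀_le_two_mul_D hh hε ω₀)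
  have hsub' := hsub.neg
  simp only [neg_sub, neg_zero] at hsub'
  refine ⟨fun ε hε => ⟨HardyExtrapolation.bddAbove_admissible₀ hh ω₀ ε,
    HardyExtrapolation.bddAbove_admissible hh ω₀ ε, HardyExtrapolation.D_pos hh hε ω₀, ?_,
    HardyExtrapolation.D_le_D₀ hh hε ω₀⟩, ?_, fun γ => ⟨fun hγ => ?_, fun hγ => ?_⟩⟩
  · linarith [HardyExtrapolation.D₀_le_two_mul_D hh hε ω₀]
  · exact le_antisymm (HardyExtrapolation.liminf_coe_le_of_tendsto_sub hsub)
      (HardyExtrapolation.liminf_coe_le_of_tendsto_sub hsub')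
  · simpa using hγ.add hsub
  · simpa using hγ.add hsub'
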